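/- Theorem 4.3. Let $\lambda$ be a partition of $n$, and draw its Young diagram in the French convention (left-justified rows of lengths $\lambda_1\ge\lambda_2\ge\cdots$ from south to north). Let $\mathrm{SYT}(\lambda)$ be the set of standard Young tableaux of shape $\lambda$, i.e. bijective labellings of the cells by $1,\dots,n$ that increase along rows (from west to east) and up columns (from south to north). For $T\in\mathrm{SYT}(\lambda)$ put $\mathrm{Des}(T)=\{(i,i+1) : i \text{ lies strictly south of } i+1 \text{ in } T\}$ and $\mathrm{maj}(T)=\sum_{(i,i+1)\in\mathrm{Des}(T)} i$. For entries $i<j$ of $T$, say (recursively) that $i$ attacks $j$ if $i$ lies strictly south and weakly east of $j$, or if $i$ lies strictly south and strictly west of $j$ and $i+1$ attacks $j$. For $k\ge 1$ put $$\mathrm{Des}_k(T)=\{(i,i+k) : i \text{ attacks } i+k\},\qquad \mathrm{Inv}_k(T)=\bigcup_{1\le j<k}\mathrm{Des}_j(T),\qquad \mathrm{maj}_k(T)=|\mathrm{Inv}_k(T)|+\sum_{(i,i+k)\in\mathrm{Des}_k(T)} i .$$ Then $$\sum_{T\in\mathrm{SYT}(\lambda)} q^{\mathrm{maj}(T)}=\sum_{T\in\mathrm{SYT}(\lambda)}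 q^{\mathrm{maj}_2(T)}=\sum_{T\in\mathrm{SYT}(\lambda)} q^{\mathrm{maj}_3(T)} .$$ -/

import Mathlib

/-- A standard Young tableau of shape `μ`: a bijective labelling of the cells of the Young diagram
`μ` by `1, …, n`, where `n = μ.card`, with entries strictly increasing along each row and along
each column.

A cell of a `YoungDiagram` is a pair `(row, column)`, and row `i` consists of the cells `(i, j)`
with `j < μ.rowLen i`. Row `0` is the longest row and it is regarded as the southernmost one
(French convention), so "further north" means a larger row index and "further east" means a
larger column index. -/
structure StandardYoungTableau (μ : YoungDiagram) where
  /-- the labelling of the cells -/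
  label : ↥μ.cells ≃ ↥(Finset.Icc 1 μ.card)
  row_lt : ∀ c d : ↥μ.cells, c.1.1 = d.1.1 → c.1.2 < d.1.2 → (label c : ℕ) < label d
  col_lt : ∀ c d : ↥μ.cells, c.1.2 = d.1.2 → c.1.1 < d.1.1 → (label c : ℕ) < label d

namespace StandardYoungTableau

variable {μ : YoungDiagram}

instance : Fintype (StandardYoungTableau μ) :=
  Fintype.ofEquiv
    { e : ↥μ.cells ≃ ↥(Finset.Icc 1 μ.card) //
      (∀ c d : ↥μ.cells, c.1.1 = d.1.1 → c.1.2 < d.1.2 → (e c : ℕ) < e d) ∧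
      (∀ c d : ↥μ.cells, c.1.2 = d.1.2 → c.1.1 < d.1.1 → (e c : ℕ) < e d) }
    { toFun := fun e => ⟨e.1, e.2.1, e.2.2⟩
      invFun := fun T => ⟨T.label, T.row_lt, T.col_lt⟩
      left_inv := fun _ => rfl
      right_inv := fun _ => rfl }

/-- The cell `(row, column)` of `T` that contains the entry `m`, for `1 ≤ m ≤ n`.
(For other `m` the value is the arbitrary pair `(0, 0)`, which is never used below.) -/
def pos (T : StandardYoungTableau μ) (m : ℕ) : ℕ × ℕ :=
  if h : m ∈ Finset.Icc 1 μ.card then (T.label.symm ⟨m, h⟩).1 else (0, 0)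

/-- The row (counted from the south, starting at `0`) of the entry `m`. -/
def row (T : StandardYoungTableau μ) (m : ℕ) : ℕ := (T.pos m).1

/-- The column (counted from the west, starting at `0`) of the entry `m`. -/
def col (T : StandardYoungTableau μ) (m : ℕ) : ℕ := (T.pos m).2

/-- For entries `i < j` of `T`, the entry `i` attacks the entry `j` if `i` lies strictly south and
weakly east of `j`, or if `i` lies strictly south and strictly west of `j` and `i + 1` attacks
`j`. -/
inductive Attacks (T : StandardYoungTableau μ) : ℕ → ℕ → Prop
  | southeast {i j : ℕ} (hi : 1 ≤ i) (hij : i < j) (hj : j ≤ μ.card)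
      (south : T.row i < T.row j) (east : T.col j ≤ T.col i) : Attacks T i j
  | southwest {i j : ℕ} (hi : 1 ≤ i) (hij : i < j) (hj : j ≤ μ.card)
      (south : T.row i < T.row j) (west : T.col i < T.col j)
      (next : Attacks T (i + 1) j) : Attacks T i j

noncomputable instance (T : StandardYoungTableau μ) (i j : ℕ) : Decidable (T.Attacks i j) :=
  Classical.propDecidable _

/-- The descent set `Des(T)`: the pairs `(i, i + 1)` of entries of `T` such that `i` lies strictly
south of `i + 1`. -/
def des (T : StandardYoungTableau μ) : Finset (ℕ × ℕ) :=
  {p ∈ Finset.Icc 1 μ.card ×ˢ Finset.Icc 1 μ.card | p.2 = p.1 + 1 ∧ T.row p.1 < T.row p.2}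

/-- The major index `maj(T)`: the sum of the `i` with `(i, i + 1) ∈ Des(T)`. -/
def maj (T : StandardYoungTableau μ) : ℕ := ∑ p ∈ T.des, p.1

/-- The `k`-descent set `Des_k(T)`: the pairs `(i, i + k)` of entries of `T` such that `i` attacks
`i + k`. -/
noncomputable def desK (k : ℕ) (T : StandardYoungTableau μ) : Finset (ℕ × ℕ) :=
  {p ∈ Finset.Icc 1 μ.card ×ˢ Finset.Icc 1 μ.card | p.2 = p.1 + k ∧ T.Attacks p.1 p.2}

/-- The set of `k`-inversions `Inv_k(T)`: the union of the `Des_j(T)` for `1 ≤ j < k`. -/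
noncomputable def invK (k : ℕ) (T : StandardYoungTableau μ) : Finset (ℕ × ℕ) :=
  (Finset.Ico 1 k).biUnion fun j => T.desK j

/-- The `k`-major index `maj_k(T)`: the number of `k`-inversions, plus the sum of the `i` with
`(i, i + k) ∈ Des_k(T)`. -/
noncomputable def majK (k : ℕ) (T : StandardYoungTableau μ) : ℕ := (T.invK k).card + ∑ p ∈ T.desK k, p.1

end StandardYoungTableau

/-!
Record a tableau `T` by its *content word* `c 1, …, c n`, where `c m` is the content (column minus
row) of the entry `m`. The tableau is determined by this word, and the words of all tableaux of a
fixed shape form a set that is closed under exchanging adjacent letters `a`, `b` with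
`1 < |a - b|` and in which no word has a factor `a a` or `a b a`
(`ContentWord.IsCommClosed`). Attacks at the distances that matter can be read off this word:
for `j = i + 1, i + 2`, the entry `i` attacks `j` iff `c j < c i`; for `j = i + 3` there is one
more case, `c i = c j`, in which `i, i + 1, i + 2, i + 3` fill a `2 × 2` square and `i` attacks `j`
iff `i + 1` does. So `maj`, `maj₂` and `maj₃` become statistics of words that are computed letter by
letter (`ContentWord.stat`), and the theorem holds for every set of words with the closure
properties above.

For such a set, let `G(u)` be the generating function of `maj_k` over the words with final factor
`u`. The engine is an exchange law: if `a + 1 < b`, then `G(b a) = q G(a b)`, for `k = 3` even with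
the letter preceding the pair prescribed, and for `k = 3` also `G(b a p) = q G(a b p)` unless
`{a, b} = {p - 1, p + 1}`. It is stated in the dual form that a sum of `q ^ maj_k`, weighted by a
function of the final letters, vanishes when the weight changes sign suitably under the exchange
(`sum_majInc₂_eq_zero`, `sum_majInc₃_eq_zero`, `sum_majInc₃_eq_zero_of_residual`). In this form the
induction is immediate: after removing the final pair, the difference of the two sides is again a
sum weighted by a function of the final letters, and that function depends only on how these
letters compare with `a` and `b`, which makes it skew. Two letters that compare differently with `a`
or `b` differ by at least `2`, because neither is equal to `a` or `b`; so they can be exchanged.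
(For `k = 3` the earlier of the two may equal `a` or `b`, but then it counts as comparing in the
same way as the other one.)

Appending a letter `x` changes `maj`, `maj₂`, `maj₃` by different amounts, but the differences of
the corresponding powers of `q` are again skew functions of the final letters, so they do not
contribute to the sum. This gives equidistribution, by induction on the length, for each prescribed
last letter (`sum_majInc₂_eq_sum_majInc`, `sum_majInc₃_eq_sum_majInc`).
-/

/-! ### Words closed under commutation of distant letters -/

namespace ContentWord

/-- Increment of the major index when the letter `x` is appended to a word. Words are stored with
their last letter first, so the appended letter is the head of the new list. -/
def majInc (x : ℤ) : List ℤ → ℕ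
  | [] => 0
  | y :: l => if x < y then l.length + 1 else 0

/-- Increment of the `2`-major index when the letter `x` is appended to a word. -/
def majInc₂ (x : ℤ) : List ℤ → ℕ
  | [] => 0
  | [y] => if x < y then 1 else 0
  | y :: z :: l => (if x < y then 1 else 0) + if x < z then l.length + 1 else 0

/-- Increment of the `3`-major index when the letter `x` is appended to a word. At distance three a
letter equal to `x` counts as an inversion if the letter after it exceeds `x`; this is the attack
across the diagonal of a `2 × 2` square. -/
def majInc₃ (x : ℤ) : List ℤ → ℕ
  | [] => 0
  | [y] => if x < y then 1 else 0
  | [y, z] => (if x < y then 1 else 0) + if x < z then 1 else 0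
  | y :: z :: w :: l => (if x < y then 1 else 0) + (if x < z then 1 else 0) +
      if x < w ∨ (x = w ∧ x < z) then l.length + 1 else 0

/-- The statistic of a word whose increment on appending a letter is `inc`. -/
def stat (inc : ℤ → List ℤ → ℕ) : List ℤ → ℕ
  | [] => 0
  | x :: l => stat inc l + inc x l

/-- A set of words of length `n` that is closed under exchanging adjacent letters differing by at
least `2`, and in whose words two equal letters are neither adjacent nor separated by a single
letter. -/
structure IsCommClosed (n : ℕ) (W : Finset (List ℤ)) : Prop where
  length_eq : ∀ v ∈ W, v.length = n
  swap_mem : ∀ s a b t, s ++ a :: b :: t ∈ W → 1 < |a - b| → s ++ b :: a :: t ∈ W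
  not_mem_aa : ∀ s a t, s ++ a :: a :: t ∉ W
  not_mem_aba : ∀ s a b t, s ++ a :: b :: a :: t ∉ W

/-- The words `v` such that `v` followed by the letter `x` belongs to `W`. -/
def residual (x : ℤ) (W : Finset (List ℤ)) : Finset (List ℤ) :=
  {v ∈ W | v.head? = some x}.image List.tail

theorem mem_residual {x : ℤ} {W : Finset (List ℤ)} {v : List ℤ} :
    v ∈ residual x W ↔ x :: v ∈ W := by
  simp only [residual, Finset.mem_image, Finset.mem_filter]
  constructor
  · rintro ⟨w, ⟨hw, h⟩, rfl⟩
    cases w with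
    | nil => simp at h
    | cons y w =>
      obtain rfl : y = x := by simpa using h
      exact hw
  · exact fun h => ⟨x :: v, ⟨h, rfl⟩, rfl⟩

theorem sum_residual {R : Type*} [AddCommMonoid R] {W : Finset (List ℤ)} {L : Finset ℤ}
    (hL : ∀ v ∈ W, ∃ x ∈ L, ∃ t, v = x :: t) (f : List ℤ → R) :
    ∑ v ∈ W, f v = ∑ x ∈ L, ∑ v ∈ residual x W, f (x :: v) := by
  rw [Finset.sum_sigma']
  symm
  refine Finset.sum_bij (fun p _ => p.1 :: p.2) ?_ ?_ ?_ ?_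
  · rintro ⟨x, v⟩ h
    exact mem_residual.1 (Finset.mem_sigma.1 h).2
  · rintro ⟨x, v⟩ _ ⟨y, w⟩ _ h
    simp only [List.cons.injEq] at h
    obtain ⟨rfl, rfl⟩ := h
    rfl
  · intro v hv
    obtain ⟨x, hx, t, rfl⟩ := hL v hv
    exact ⟨⟨x, t⟩, Finset.mem_sigma.2 ⟨hx, mem_residual.2 hv⟩, rfl⟩
  · intros
    rfl

namespace IsCommClosed

variable {n : ℕ} {W : Finset (List ℤ)}

theorem residual (h : IsCommClosed (n + 1) W) (x : ℤ) :
    IsCommClosed n (ContentWord.residual x W) where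
  length_eq v hv := by simpa using h.length_eq _ (mem_residual.1 hv)
  swap_mem s a b t hv hab :=
    mem_residual.2 (h.swap_mem (x :: s) a b t (mem_residual.1 hv) hab)
  not_mem_aa s a t hv := h.not_mem_aa (x :: s) a t (mem_residual.1 hv)
  not_mem_aba s a b t hv := h.not_mem_aba (x :: s) a b t (mem_residual.1 hv)

theorem exists_cons (h : IsCommClosed (n + 1) W) :
    ∃ L : Finset ℤ, ∀ v ∈ W, ∃ x ∈ L, ∃ t, v = x :: t := by
  refine ⟨W.biUnion List.toFinset, fun v hv => ?_⟩
  obtain ⟨x, t, rfl⟩ := List.exists_cons_of_length_eq_add_one (h.length_eq v hv)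
  exact ⟨x, Finset.mem_biUnion.2 ⟨_, hv, by simp⟩, t, rfl⟩

/-- A sum over `W` vanishes if the contributions of the words with final pair `a b` and `b a` cancel
for distant `a`, `b`, and the words whose final letters are close do not contribute. -/
theorem sum_eq_zero_of_pair {R : Type*} [AddCommGroup R] (h : IsCommClosed (n + 2) W)
    (f : List ℤ → R)
    (hclose : ∀ a b t, a :: b :: t ∈ W → |a - b| ≤ 1 → f (a :: b :: t) = 0)
    (hfar : ∀ a b, a + 1 < b → ∑ v ∈ ContentWord.residual b (ContentWord.residual a W),
      (f (a :: b :: v) + f (b :: a :: v)) = 0) :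
    ∑ v ∈ W, f v = 0 := by
  have hL : ∀ v ∈ W, ∃ x ∈ W.biUnion List.toFinset, ∃ t, v = x :: t := fun v hv => by
    obtain ⟨x, t, rfl⟩ := List.exists_cons_of_length_eq_add_one (h.length_eq v hv)
    exact ⟨x, Finset.mem_biUnion.2 ⟨_, hv, by simp⟩, t, rfl⟩
  have hL' : ∀ a, ∀ v ∈ ContentWord.residual a W,
      ∃ x ∈ W.biUnion List.toFinset, ∃ t, v = x :: t := fun a v hv => by
    obtain ⟨x, t, rfl⟩ := List.exists_cons_of_length_eq_add_one ((h.residual a).length_eq v hv)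
    exact ⟨x, Finset.mem_biUnion.2 ⟨_, mem_residual.1 hv, by simp⟩, t, rfl⟩
  rw [sum_residual hL]
  rw [Finset.sum_congr rfl fun a _ => sum_residual (hL' a) fun v => f (a :: v)]
  rw [← Finset.sum_product']
  have comm : ∀ a b, 1 < |a - b| → ContentWord.residual b (ContentWord.residual a W) =
      ContentWord.residual a (ContentWord.residual b W) := fun a b hab => by
    ext v
    simp only [mem_residual]
    exact ⟨fun hv => h.swap_mem [] a b v hv hab,
      fun hv => h.swap_mem [] b a v hv (by rwa [abs_sub_comm])⟩
  refine Finset.sum_involution (fun p _ => p.swap) ?_ ?_ ?_ ?_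
  · rintro ⟨a, b⟩ -
    simp only [Prod.swap]
    rcases le_or_gt |a - b| 1 with hab | hab
    · rw [Finset.sum_eq_zero, Finset.sum_eq_zero, add_zero]
      · exact fun v hv => hclose _ _ _ (mem_residual.1 (mem_residual.1 hv))
          (by rwa [abs_sub_comm])
      · exact fun v hv => hclose _ _ _ (mem_residual.1 (mem_residual.1 hv)) hab
    · rw [← comm a b hab, ← Finset.sum_add_distrib]
      rcases lt_abs.1 hab with hlt | hlt
      · rw [comm a b hab, ← hfar b a (by lia)]
        exact Finset.sum_congr rfl fun v _ => add_comm _ _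
      · exact hfar a b (by lia)
  · rintro ⟨a, b⟩ - hne heq
    obtain rfl : b = a := (Prod.ext_iff.1 heq).1
    exact hne (Finset.sum_eq_zero fun v hv =>
      absurd (mem_residual.1 (mem_residual.1 hv)) (h.not_mem_aa [] _ v))
  · rintro ⟨a, b⟩ hp
    simpa [and_comm] using hp
  · intros
    rfl

end IsCommClosed

/-! ### The exchange laws -/

section Exchange

variable {R : Type*} [CommRing R] (q : R)

/-- Exchange of the last two letters for the `2`-major index: a weight `F` of the last two letters
that is `q`-skew under their exchange, and zero where they cannot be exchanged, sums to zero. -/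
theorem sum_majInc₂_eq_zero (n : ℕ) : ∀ (W : Finset (List ℤ)), IsCommClosed (n + 2) W →
    ∀ (f : List ℤ → R) (F : ℤ → ℤ → R), (∀ a b t, a :: b :: t ∈ W → f (a :: b :: t) = F a b) →
    (∀ a b t, a :: b :: t ∈ W → |a - b| ≤ 1 → F a b = 0) →
    (∀ a b t, a :: b :: t ∈ W → a + 1 < b → F b a = -q * F a b) →
    ∑ v ∈ W, f v * q ^ stat majInc₂ v = 0 := by
  induction n using Nat.strong_induction_on with
  | _ n ih =>
  intro W hW f F hf hclose hfar
  refine hW.sum_eq_zero_of_pair _ (fun a b t hv hab => ?_) (fun a b hab => ?_)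
  · rw [hf a b t hv, hclose a b t hv hab, zero_mul]
  have hU : IsCommClosed n (residual b (residual a W)) := (hW.residual a).residual b
  have hmem : ∀ v ∈ residual b (residual a W), a :: b :: v ∈ W ∧ b :: a :: v ∈ W := fun v hv =>
    have := mem_residual.1 (mem_residual.1 hv)
    ⟨this, hW.swap_mem [] a b v this (by rw [lt_abs]; right; lia)⟩
  have key : ∀ v ∈ residual b (residual a W),
      f (a :: b :: v) * q ^ stat majInc₂ (a :: b :: v) +
        f (b :: a :: v) * q ^ stat majInc₂ (b :: a :: v) =
      F a b * ((q ^ (majInc₂ b v + majInc₂ a (b :: v)) -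
        q * q ^ (majInc₂ a v + majInc₂ b (a :: v))) * q ^ stat majInc₂ v) := fun v hv => by
    rw [hf _ _ _ (hmem v hv).1, hf _ _ _ (hmem v hv).2, hfar a b v (hmem v hv).1 hab]
    simp only [stat, pow_add]
    ring
  rw [Finset.sum_congr rfl key, ← Finset.mul_sum]
  suffices ∑ v ∈ residual b (residual a W), (q ^ (majInc₂ b v + majInc₂ a (b :: v)) -
      q * q ^ (majInc₂ a v + majInc₂ b (a :: v))) * q ^ stat majInc₂ v = 0 by
    rw [this, mul_zero]
  have hlt : a < b := by lia
  have hnlt : ¬ b < a := by lia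
  match n, ih, hU with
  | 0, _, hU =>
    refine Finset.sum_eq_zero fun v hv => ?_
    obtain rfl := List.length_eq_zero_iff.1 (hU.length_eq v hv)
    simp [majInc₂, hlt, hnlt]
  | 1, _, hU =>
    refine Finset.sum_eq_zero fun v hv => ?_
    obtain ⟨p, rfl⟩ := List.length_eq_one_iff.1 (hU.length_eq v hv)
    simp only [majInc₂, hlt, hnlt, if_true, if_false, List.length_nil]
    ring
  | n + 2, ih, hU =>
    refine ih n (by lia) _ hU _
      (fun p c => q ^ ((if b < p then 1 else 0) + (if b < c then n + 1 else 0) +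
          (1 + if a < p then n + 2 else 0)) -
        q * q ^ ((if a < p then 1 else 0) + (if a < c then n + 1 else 0) +
          (0 + if b < p then n + 2 else 0)))
      (fun p c t hv => ?_) (fun p c t hv hpc => ?_) (fun p c t hv hpc => ?_)
    · have : t.length = n := by simpa using hU.length_eq _ hv
      simp [majInc₂, this, hlt, hnlt]
    all_goals
      obtain ⟨h1, h2⟩ := hmem _ hv
      have pa : p ≠ a := by rintro rfl; exact hW.not_mem_aa [b] _ _ h2
      have pb : p ≠ b := by rintro rfl; exact hW.not_mem_aa [a] _ _ h1
      have ca : c ≠ a := by rintro rfl; exact hW.not_mem_aba [b] _ _ _ h2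
      have cb : c ≠ b := by rintro rfl; exact hW.not_mem_aba [a] _ _ _ h1
    · rw [abs_le] at hpc
      split_ifs <;> first | omega | ring1
    · split_ifs <;> first | omega | ring1

/-- Exchange of the second and third letter from the end for the `3`-major index, deduced from
the exchange of the last two letters in shorter words. The weight must vanish when these letters are
`p ± 1`, where `p` is the last letter: only then can a letter `p` stand three places before the
end, and then the exchange alters whether it attacks the last letter. -/
theorem sum_majInc₃_eq_zero_of_residual (n : ℕ)
    (ih : ∀ (W : Finset (List ℤ)), IsCommClosed (n + 2) W →
      ∀ (f : List ℤ → R) (F : ℤ → ℤ → Option ℤ → R),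
      (∀ a b t, a :: b :: t ∈ W → f (a :: b :: t) = F a b t.head?) →
      (∀ a b t, a :: b :: t ∈ W → |a - b| ≤ 1 → F a b t.head? = 0) →
      (∀ a b t, a :: b :: t ∈ W → a + 1 < b → F b a t.head? = -q * F a b t.head?) →
      ∑ v ∈ W, f v * q ^ stat majInc₃ v = 0)
    {W : Finset (List ℤ)} (hW : IsCommClosed (n + 3) W) (f : List ℤ → R) (F : ℤ → ℤ → ℤ → R)
    (hf : ∀ p a b t, p :: a :: b :: t ∈ W → f (p :: a :: b :: t) = F p a b)
    (hclose : ∀ p a b t, p :: a :: b :: t ∈ W → |a - b| ≤ 1 → F p a b = 0)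
    (hfar : ∀ p a b t, p :: a :: b :: t ∈ W → a + 1 < b → F p b a = -q * F p a b)
    (hmid : ∀ p t, p :: (p - 1) :: (p + 1) :: t ∈ W → F p (p - 1) (p + 1) = 0) :
    ∑ v ∈ W, f v * q ^ stat majInc₃ v = 0 := by
  obtain ⟨L, hL⟩ := hW.exists_cons
  rw [sum_residual hL]
  refine Finset.sum_eq_zero fun p _ => ?_
  simp only [stat, pow_add, mul_comm (q ^ stat majInc₃ _), ← mul_assoc]
  refine ih _ (hW.residual p) _ (fun a b e => F p a b *
    q ^ ((if p < a then 1 else 0) + (if p < b then 1 else 0) +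
      e.elim 0 fun e => if p < e ∨ (p = e ∧ p < b) then n else 0)) ?_ ?_ ?_
  · intro a b t hv
    rw [mem_residual] at hv
    rw [hf _ _ _ _ hv]
    have hl : t.length = n := by simpa using hW.length_eq _ hv
    cases t with
    | nil => simp [majInc₃]
    | cons e t =>
      have hl : t.length + 1 = n := by simpa using hl
      simp [majInc₃, hl]
  · intro a b t hv hab
    rw [hclose _ _ _ _ (mem_residual.1 hv) hab, zero_mul]
  · intro a b t hv hab
    rw [mem_residual] at hv
    rw [hfar _ _ _ _ hv hab]
    -- The letter `e` before the pair feels the exchange only if `e = p`; in that case the pair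
    -- has to be `p ± 1`, since otherwise a factor `p b p` or `p a p` could be produced.
    by_cases he : t.head? = some p
    · obtain ⟨t, rfl⟩ : ∃ t', t = p :: t' := by
        cases t with
        | nil => simp at he
        | cons y t => exact ⟨t, by simpa using he⟩
      have ha : a ≠ p := by rintro rfl; exact hW.not_mem_aa [] _ _ hv
      have hb : b ≠ p := by rintro rfl; exact hW.not_mem_aba [] _ _ _ hv
      have ha' : |p - a| ≤ 1 := by
        by_contra! h
        exact hW.not_mem_aba [a] _ _ _ (hW.swap_mem [] p a _ hv h)
      have hb' : |b - p| ≤ 1 := by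
        by_contra! h
        exact hW.not_mem_aba [] _ _ _ (hW.swap_mem [p, a] b p _ hv h)
      rw [abs_le] at ha' hb'
      obtain rfl : a = p - 1 := by lia
      obtain rfl : b = p + 1 := by lia
      rw [hmid p _ hv]
      simp
    · have : (t.head?.elim 0 fun e => if p < e ∨ (p = e ∧ p < b) then n else 0) =
          t.head?.elim 0 fun e => if p < e ∨ (p = e ∧ p < a) then n else 0 := by
        cases h : t.head? with
        | none => rfl
        | some e =>
          have : p ≠ e := by rintro rfl; exact he h
          simp [this]
      rw [this]
      ring

/-- Exchange of the last two letters for the `3`-major index. The weight `F` may also depend on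
the letter before them, if there is one. -/
theorem sum_majInc₃_eq_zero (n : ℕ) : ∀ (W : Finset (List ℤ)), IsCommClosed (n + 2) W →
    ∀ (f : List ℤ → R) (F : ℤ → ℤ → Option ℤ → R),
    (∀ a b t, a :: b :: t ∈ W → f (a :: b :: t) = F a b t.head?) →
    (∀ a b t, a :: b :: t ∈ W → |a - b| ≤ 1 → F a b t.head? = 0) →
    (∀ a b t, a :: b :: t ∈ W → a + 1 < b → F b a t.head? = -q * F a b t.head?) →
    ∑ v ∈ W, f v * q ^ stat majInc₃ v = 0 := by
  induction n using Nat.strong_induction_on with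
  | _ n ih =>
  intro W hW f F hf hclose hfar
  refine hW.sum_eq_zero_of_pair _ (fun a b t hv hab => ?_) (fun a b hab => ?_)
  · rw [hf a b t hv, hclose a b t hv hab, zero_mul]
  have hU : IsCommClosed n (residual b (residual a W)) := (hW.residual a).residual b
  have hmem : ∀ v ∈ residual b (residual a W), a :: b :: v ∈ W ∧ b :: a :: v ∈ W := fun v hv =>
    have := mem_residual.1 (mem_residual.1 hv)
    ⟨this, hW.swap_mem [] a b v this (by rw [lt_abs]; right; lia)⟩
  have key : ∀ v ∈ residual b (residual a W),
      f (a :: b :: v) * q ^ stat majInc₃ (a :: b :: v) +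
        f (b :: a :: v) * q ^ stat majInc₃ (b :: a :: v) =
      F a b v.head? * (q ^ (majInc₃ b v + majInc₃ a (b :: v)) -
        q * q ^ (majInc₃ a v + majInc₃ b (a :: v))) * q ^ stat majInc₃ v := fun v hv => by
    rw [hf _ _ _ (hmem v hv).1, hf _ _ _ (hmem v hv).2, hfar a b v (hmem v hv).1 hab]
    simp only [stat, pow_add]
    ring
  rw [Finset.sum_congr rfl key]
  have hlt : a < b := by lia
  have hnlt : ¬ b < a := by lia
  match n, ih, hU with
  | 0, _, hU =>
    refine Finset.sum_eq_zero fun v hv => ?_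
    obtain rfl := List.length_eq_zero_iff.1 (hU.length_eq v hv)
    simp [majInc₃, hlt, hnlt]
  | 1, _, hU =>
    refine Finset.sum_eq_zero fun v hv => ?_
    obtain ⟨p, rfl⟩ := List.length_eq_one_iff.1 (hU.length_eq v hv)
    simp only [majInc₃, hlt, hnlt, if_true, if_false]
    ring
  | 2, _, hU =>
    refine Finset.sum_eq_zero fun v hv => ?_
    obtain ⟨p, c, rfl⟩ := List.length_eq_two.1 (hU.length_eq v hv)
    obtain ⟨h1, h2⟩ := hmem _ hv
    have ca : a ≠ c := by rintro rfl; exact hW.not_mem_aba [b] _ _ _ h2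
    have cb : b ≠ c := by rintro rfl; exact hW.not_mem_aba [a] _ _ _ h1
    simp only [majInc₃, hlt, hnlt, if_true, if_false, ca, cb, false_and, or_false,
      List.length_nil]
    ring
  | n + 3, ih, hU =>
    refine sum_majInc₃_eq_zero_of_residual q n (ih n (by lia)) hU _
      (fun p c d => F a b (some p) *
        (q ^ ((if b < p then 1 else 0) + (if b < c then 1 else 0) +
            (if b < d ∨ (b = d ∧ b < c) then n + 1 else 0) +
            (1 + (if a < p then 1 else 0) + if a < c then n + 2 else 0)) -
          q * q ^ ((if a < p then 1 else 0) + (if a < c then 1 else 0) +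
            (if a < d ∨ (a = d ∧ a < c) then n + 1 else 0) +
            (0 + (if b < p then 1 else 0) + if b < c then n + 2 else 0))))
      (fun p c d t hv => ?_) (fun p c d t hv hcd => ?_) (fun p c d t hv hcd => ?_)
      (fun p t hv => ?_)
    · have : t.length = n := by simpa using hU.length_eq _ hv
      obtain ⟨h1, h2⟩ := hmem _ hv
      have ca : a ≠ c := by rintro rfl; exact hW.not_mem_aba [b] _ _ _ h2
      have cb : b ≠ c := by rintro rfl; exact hW.not_mem_aba [a] _ _ _ h1
      simp [majInc₃, this, hlt, hnlt, ca, cb]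
    all_goals
      obtain ⟨h1, h2⟩ := hmem _ hv
      have pa : p ≠ a := by rintro rfl; exact hW.not_mem_aa [b] _ _ h2
      have pb : p ≠ b := by rintro rfl; exact hW.not_mem_aa [a] _ _ h1
    · have ca : c ≠ a := by rintro rfl; exact hW.not_mem_aba [b] _ _ _ h2
      have cb : c ≠ b := by rintro rfl; exact hW.not_mem_aba [a] _ _ _ h1
      rw [abs_le] at hcd
      -- If `d` equals `a` or `b`, the tie is broken in the way `c` compares.
      have ea : (a < d ∨ (a = d ∧ a < c)) ↔ a < c := by lia
      have eb : (b < d ∨ (b = d ∧ b < c)) ↔ b < c := by lia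
      simp only [ea, eb]
      split_ifs <;> first | omega | ring1
    · have ca : c ≠ a := by rintro rfl; exact hW.not_mem_aba [b] _ _ _ h2
      have cb : c ≠ b := by rintro rfl; exact hW.not_mem_aba [a] _ _ _ h1
      have hcd' : 1 < |c - d| := by rw [lt_abs]; right; lia
      have da : d ≠ a := by
        rintro rfl; exact hW.not_mem_aba [b] _ _ _ (hW.swap_mem [b, d, p] _ _ _ h2 hcd')
      have db : d ≠ b := by
        rintro rfl; exact hW.not_mem_aba [a] _ _ _ (hW.swap_mem [a, d, p] _ _ _ h1 hcd')
      simp only [da.symm, db.symm, ca.symm, cb.symm, false_and, or_false]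
      generalize (if a < p then 1 else 0) = A, (if b < p then 1 else 0) = B
      split_ifs <;> first | omega | ring1
    · have ca : p - 1 ≠ a := by rintro rfl; exact hW.not_mem_aba [b] _ _ _ h2
      have cb : p - 1 ≠ b := by rintro rfl; exact hW.not_mem_aba [a] _ _ _ h1
      have hcd' : 1 < |p - 1 - (p + 1)| := by rw [lt_abs]; right; lia
      have da : p + 1 ≠ a := by
        rintro rfl; exact hW.not_mem_aba [b] _ _ _ (hW.swap_mem [b, p + 1, p] _ _ _ h2 hcd')
      have db : p + 1 ≠ b := by
        rintro rfl; exact hW.not_mem_aba [a] _ _ _ (hW.swap_mem [a, p + 1, p] _ _ _ h1 hcd')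
      simp only [da.symm, db.symm, false_and, or_false]
      split_ifs <;> first | omega | ring1

/-! ### Equidistribution on words -/

/-- The major index and the `2`-major index are equidistributed, also jointly with the last
letter. -/
theorem sum_majInc₂_eq_sum_majInc (n : ℕ) : ∀ (W : Finset (List ℤ)), IsCommClosed n W →
    ∀ g : Option ℤ → R, ∑ v ∈ W, g v.head? * q ^ stat majInc₂ v =
      ∑ v ∈ W, g v.head? * q ^ stat majInc v := by
  induction n with
  | zero =>
    intro W hW g
    refine Finset.sum_congr rfl fun v hv => ?_
    rw [List.length_eq_zero_iff.1 (hW.length_eq v hv)]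
    rfl
  | succ n ih =>
    intro W hW g
    obtain ⟨L, hL⟩ := hW.exists_cons
    rw [sum_residual hL, sum_residual hL]
    refine Finset.sum_congr rfl fun x _ => ?_
    have hU := hW.residual x
    simp only [List.head?_cons, stat, pow_add, ← Finset.mul_sum]
    congr 1
    have hinc : ∀ v ∈ residual x W, q ^ stat majInc v * q ^ majInc x v =
        (v.head?.elim 1 fun y => q ^ (if x < y then n else 0)) * q ^ stat majInc v := by
      intro v hv
      have hl := hU.length_eq v hv
      rw [mul_comm]
      cases v with
      | nil => simp [majInc]
      | cons y t =>
        have hl : t.length + 1 = n := by simpa using hl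
        simp [majInc, hl]
    rw [Finset.sum_congr rfl hinc, ← ih _ hU fun o =>
      o.elim 1 fun y => q ^ (if x < y then n else 0), ← sub_eq_zero, ← Finset.sum_sub_distrib]
    simp only [mul_comm (q ^ stat majInc₂ _), ← sub_mul]
    match n, hU with
    | 0, hU =>
      refine Finset.sum_eq_zero fun v hv => ?_
      obtain rfl := List.length_eq_zero_iff.1 (hU.length_eq v hv)
      simp [majInc₂]
    | 1, hU =>
      refine Finset.sum_eq_zero fun v hv => ?_
      obtain ⟨p, rfl⟩ := List.length_eq_one_iff.1 (hU.length_eq v hv)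
      simp [majInc₂]
    | n + 2, hU =>
      refine sum_majInc₂_eq_zero q n _ hU _
        (fun y z => q ^ ((if x < y then 1 else 0) + if x < z then n + 1 else 0) -
          q ^ (if x < y then n + 2 else 0))
        (fun y z t hv => ?_) (fun y z t hv hyz => ?_) (fun y z t hv hyz => ?_)
      · have : t.length = n := by simpa using hU.length_eq _ hv
        simp [majInc₂, this]
      all_goals
        rw [mem_residual] at hv
        have hy : y ≠ x := by rintro rfl; exact hW.not_mem_aa [] _ _ hv
        have hz : z ≠ x := by rintro rfl; exact hW.not_mem_aba [] _ _ _ hv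
      · rw [abs_le] at hyz
        split_ifs <;> first | omega | ring1
      · split_ifs <;> first | omega | ring1

/-- The major index and the `3`-major index are equidistributed, also jointly with the last
letter. -/
theorem sum_majInc₃_eq_sum_majInc (n : ℕ) : ∀ (W : Finset (List ℤ)), IsCommClosed n W →
    ∀ g : Option ℤ → R, ∑ v ∈ W, g v.head? * q ^ stat majInc₃ v =
      ∑ v ∈ W, g v.head? * q ^ stat majInc v := by
  induction n with
  | zero =>
    intro W hW g
    refine Finset.sum_congr rfl fun v hv => ?_
    rw [List.length_eq_zero_iff.1 (hW.length_eq v hv)]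
    rfl
  | succ n ih =>
    intro W hW g
    obtain ⟨L, hL⟩ := hW.exists_cons
    rw [sum_residual hL, sum_residual hL]
    refine Finset.sum_congr rfl fun x _ => ?_
    have hU := hW.residual x
    simp only [List.head?_cons, stat, pow_add, ← Finset.mul_sum]
    congr 1
    have hinc : ∀ v ∈ residual x W, q ^ stat majInc v * q ^ majInc x v =
        (v.head?.elim 1 fun y => q ^ (if x < y then n else 0)) * q ^ stat majInc v := by
      intro v hv
      have hl := hU.length_eq v hv
      rw [mul_comm]
      cases v with
      | nil => simp [majInc]
      | cons y t =>
        have hl : t.length + 1 = n := by simpa using hl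
        simp [majInc, hl]
    rw [Finset.sum_congr rfl hinc, ← ih _ hU fun o =>
      o.elim 1 fun y => q ^ (if x < y then n else 0)]
    -- Pass through the increment of the `2`-major index: its difference to that of the
    -- `3`-major index is skew in the second and third letter from the end, its difference to that
    -- of the major index is skew in the last two.
    trans ∑ v ∈ residual x W, q ^ majInc₂ x v * q ^ stat majInc₃ v
    · rw [← sub_eq_zero, ← Finset.sum_sub_distrib]
      simp only [mul_comm (q ^ stat majInc₃ _), ← sub_mul]
      match n, hU with
      | 0, hU =>
        refine Finset.sum_eq_zero fun v hv => ?_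
        obtain rfl := List.length_eq_zero_iff.1 (hU.length_eq v hv)
        simp [majInc₂, majInc₃]
      | 1, hU =>
        refine Finset.sum_eq_zero fun v hv => ?_
        obtain ⟨p, rfl⟩ := List.length_eq_one_iff.1 (hU.length_eq v hv)
        simp [majInc₂, majInc₃]
      | 2, hU =>
        refine Finset.sum_eq_zero fun v hv => ?_
        obtain ⟨p, c, rfl⟩ := List.length_eq_two.1 (hU.length_eq v hv)
        simp [majInc₂, majInc₃]
      | n + 3, hU =>
        refine sum_majInc₃_eq_zero_of_residual q n (sum_majInc₃_eq_zero q n) hU _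
          (fun y z w => q ^ ((if x < y then 1 else 0) + (if x < z then 1 else 0) +
            if x < w ∨ (x = w ∧ x < z) then n + 1 else 0) -
            q ^ ((if x < y then 1 else 0) + if x < z then n + 2 else 0))
          (fun y z w t hv => ?_) (fun y z w t hv hyz => ?_) (fun y z w t hv hyz => ?_)
          (fun y t hv => ?_)
        · have : t.length = n := by simpa using hU.length_eq _ hv
          simp [majInc₂, majInc₃, this]
        all_goals
          rw [mem_residual] at hv
          have hy : y ≠ x := by rintro rfl; exact hW.not_mem_aa [] _ _ hv
        · have hz : z ≠ x := by rintro rfl; exact hW.not_mem_aba [] _ _ _ hv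
          rw [abs_le] at hyz
          split_ifs <;> first | omega | ring1
        · have hz : z ≠ x := by rintro rfl; exact hW.not_mem_aba [] _ _ _ hv
          have hw : w ≠ x := by
            rintro rfl
            exact hW.not_mem_aba [] _ _ _
              (hW.swap_mem [w, y] _ _ _ hv (by rw [lt_abs]; right; lia))
          split_ifs <;> first | omega | ring1
        · have hz : y - 1 ≠ x := by rintro rfl; exact hW.not_mem_aba [] _ _ _ hv
          have hw : y + 1 ≠ x := by
            rintro rfl
            exact hW.not_mem_aba [] _ _ _
              (hW.swap_mem [y + 1, y] _ _ _ hv (by rw [lt_abs]; right; lia))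
          split_ifs <;> first | omega | ring1
    · rw [← sub_eq_zero, ← Finset.sum_sub_distrib]
      simp only [← sub_mul]
      match n, hU with
      | 0, hU =>
        refine Finset.sum_eq_zero fun v hv => ?_
        obtain rfl := List.length_eq_zero_iff.1 (hU.length_eq v hv)
        simp [majInc₂]
      | 1, hU =>
        refine Finset.sum_eq_zero fun v hv => ?_
        obtain ⟨p, rfl⟩ := List.length_eq_one_iff.1 (hU.length_eq v hv)
        simp [majInc₂]
      | n + 2, hU =>
        refine sum_majInc₃_eq_zero q n _ hU _
          (fun y z _ => q ^ ((if x < y then 1 else 0) + if x < z then n + 1 else 0) -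
            q ^ (if x < y then n + 2 else 0))
          (fun y z t hv => ?_) (fun y z t hv hyz => ?_) (fun y z t hv hyz => ?_)
        · have : t.length = n := by simpa using hU.length_eq _ hv
          simp [majInc₂, this]
        all_goals
          rw [mem_residual] at hv
          have hy : y ≠ x := by rintro rfl; exact hW.not_mem_aa [] _ _ hv
          have hz : z ≠ x := by rintro rfl; exact hW.not_mem_aba [] _ _ _ hv
        · rw [abs_le] at hyz
          split_ifs <;> first | omega | ring1
        · split_ifs <;> first | omega | ring1

end Exchange

end ContentWord

/-! ### Words from sequences -/

namespace ContentWord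

/-- The word `c 1, …, c n`, stored with its last letter first. -/
def ofSeq (c : ℕ → ℤ) : ℕ → List ℤ
  | 0 => []
  | n + 1 => c (n + 1) :: ofSeq c n

theorem length_ofSeq (c : ℕ → ℤ) (n : ℕ) : (ofSeq c n).length = n := by
  induction n with
  | zero => rfl
  | succ n ih => simp [ofSeq, ih]

theorem ofSeq_congr {c d : ℕ → ℤ} {n : ℕ} :
    ofSeq c n = ofSeq d n ↔ ∀ i, 1 ≤ i → i ≤ n → c i = d i := by
  induction n with
  | zero => exact ⟨fun _ i _ _ => by lia, fun _ => rfl⟩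
  | succ n ih =>
    simp only [ofSeq, List.cons.injEq, ih]
    refine ⟨fun h i h1 hn => ?_, fun h => ⟨h _ (by lia) le_rfl, fun i h1 hn => h i h1 (by lia)⟩⟩
    rcases hn.lt_or_eq with hlt | rfl
    · exact h.2 i h1 (by lia)
    · exact h.1

theorem ofSeq_eq_append {c : ℕ → ℤ} {n : ℕ} {s t : List ℤ} (h : ofSeq c n = s ++ t) :
    t = ofSeq c t.length ∧ t.length ≤ n := by
  induction s generalizing n with
  | nil =>
    obtain rfl : ofSeq c n = t := h
    simp [length_ofSeq]
  | cons x s ih =>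
    cases n with
    | zero => simp [ofSeq] at h
    | succ n =>
      have := ih (List.cons.inj h).2
      exact ⟨this.1, by lia⟩

theorem ofSeq_comp_swap {c : ℕ → ℤ} {n i : ℕ} {s : List ℤ} {a b : ℤ}
    (h : ofSeq c n = s ++ a :: b :: ofSeq c i) :
    ofSeq (c ∘ Equiv.swap (i + 1) (i + 2)) n = s ++ b :: a :: ofSeq c i := by
  induction s generalizing n with
  | nil =>
    obtain rfl : n = i + 2 := by simpa [length_ofSeq] using congrArg List.length h
    simp only [ofSeq, List.nil_append, List.cons.injEq] at h
    obtain ⟨rfl, rfl, -⟩ := h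
    simp only [ofSeq, List.nil_append, List.cons.injEq, Function.comp_apply,
      Equiv.swap_apply_left, Equiv.swap_apply_right, true_and, ofSeq_congr]
    intro k _ hk
    rw [Equiv.swap_apply_of_ne_of_ne (by lia) (by lia)]
  | cons x s ih =>
    cases n with
    | zero => simp [ofSeq] at h
    | succ n =>
      rw [ofSeq, List.cons_append, List.cons.injEq] at h
      obtain ⟨rfl, h⟩ := h
      have hn : n = s.length + (i + 1 + 1) := by
        simpa [length_ofSeq] using congrArg List.length h
      rw [ofSeq, List.cons_append, ih h, Function.comp_apply,
        Equiv.swap_apply_of_ne_of_ne (by lia) (by lia)]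

theorem stat_majInc_ofSeq (c : ℕ → ℤ) (n : ℕ) : stat majInc (ofSeq c n) =
    ∑ j ∈ Finset.range n, if 1 ≤ j ∧ c (j + 1) < c j then j else 0 := by
  induction n with
  | zero => rfl
  | succ n ih =>
    rw [Finset.sum_range_succ, ← ih, ofSeq, stat]
    congr 1
    cases n <;> simp [ofSeq, majInc, length_ofSeq]

theorem stat_majInc₂_ofSeq (c : ℕ → ℤ) (n : ℕ) : stat majInc₂ (ofSeq c n) =
    ∑ j ∈ Finset.range n, ((if 1 ≤ j ∧ c (j + 1) < c j then 1 else 0) +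
      if 2 ≤ j ∧ c (j + 1) < c (j - 1) then j - 1 else 0) := by
  induction n with
  | zero => rfl
  | succ n ih =>
    rw [Finset.sum_range_succ, ← ih, ofSeq, stat]
    congr 1
    match n with
    | 0 | 1 | n + 2 => simp [ofSeq, majInc₂, length_ofSeq]

theorem stat_majInc₃_ofSeq (c : ℕ → ℤ) (n : ℕ) : stat majInc₃ (ofSeq c n) =
    ∑ j ∈ Finset.range n, ((if 1 ≤ j ∧ c (j + 1) < c j then 1 else 0) +
      (if 2 ≤ j ∧ c (j + 1) < c (j - 1) then 1 else 0) +
      if 3 ≤ j ∧ (c (j + 1) < c (j - 2) ∨ (c (j + 1) = c (j - 2) ∧ c (j + 1) < c (j - 1)))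
        then j - 2 else 0) := by
  induction n with
  | zero => rfl
  | succ n ih =>
    rw [Finset.sum_range_succ, ← ih, ofSeq, stat]
    congr 1
    match n with
    | 0 | 1 | 2 | n + 3 => simp [ofSeq, majInc₃, length_ofSeq]

end ContentWord

/-! ### Contents and attacks in a tableau -/

namespace StandardYoungTableau

open ContentWord

variable {μ : YoungDiagram}

section Geometry

variable (T : StandardYoungTableau μ)

theorem pos_label (c : μ.cells) : T.pos (T.label c) = c.1 := by
  rw [pos, dif_pos (T.label c).2]
  simp

theorem exists_cell {m : ℕ} (h1 : 1 ≤ m) (hm : m ≤ μ.card) : ∃ c, (T.label c : ℕ) = m :=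
  ⟨T.label.symm ⟨m, Finset.mem_Icc.2 ⟨h1, hm⟩⟩, by simp⟩

theorem pos_mem {m : ℕ} (h1 : 1 ≤ m) (hm : m ≤ μ.card) : (T.row m, T.col m) ∈ μ := by
  obtain ⟨c, rfl⟩ := T.exists_cell h1 hm
  rw [row, col, pos_label]
  exact c.2

theorem exists_entry {r c : ℕ} (h : (r, c) ∈ μ) :
    ∃ m, 1 ≤ m ∧ m ≤ μ.card ∧ T.row m = r ∧ T.col m = c := by
  have := Finset.mem_Icc.1 (T.label ⟨(r, c), h⟩).2
  exact ⟨T.label ⟨(r, c), h⟩, this.1, this.2, by simp [row, pos_label], by simp [col, pos_label]⟩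

/-- An entry weakly northeast of another one is larger: compare both with the entry in the corner
of the rectangle that they span. -/
theorem lt_of_row_le_col_le {i j : ℕ} (hi : 1 ≤ i) (hi' : i ≤ μ.card) (hj : 1 ≤ j)
    (hj' : j ≤ μ.card) (hr : T.row i ≤ T.row j) (hc : T.col i ≤ T.col j) (hne : i ≠ j) :
    i < j := by
  refine lt_of_le_of_ne ?_ hne
  have he : (T.row i, T.col j) ∈ μ := μ.up_left_mem hr le_rfl (T.pos_mem hj hj')
  obtain ⟨a, rfl⟩ := T.exists_cell hi hi'
  obtain ⟨b, rfl⟩ := T.exists_cell hj hj'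
  simp only [row, col, pos_label] at hr hc he
  trans (T.label ⟨_, he⟩ : ℕ)
  · rcases hc.lt_or_eq with h | h
    · exact (T.row_lt a ⟨_, he⟩ rfl h).le
    · exact le_of_eq (congrArg _ (congrArg _ (Subtype.ext (Prod.ext rfl h))))
  · rcases hr.lt_or_eq with h | h
    · exact (T.col_lt ⟨_, he⟩ b rfl h).le
    · exact le_of_eq (congrArg _ (congrArg _ (Subtype.ext (Prod.ext h rfl))))

/-- The content (column minus row) of the cell of `T` that contains `m`. -/
def content (m : ℕ) : ℤ := T.col m - T.row m

variable {T} {i j : ℕ}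

theorem row_lt_or_col_lt (hi : 1 ≤ i) (hij : i < j) (hj : j ≤ μ.card) :
    T.row i < T.row j ∨ T.col i < T.col j := by
  by_contra! h
  have := T.lt_of_row_le_col_le (by lia) hj hi (by lia) h.1 h.2 hij.ne'
  lia

/-- If `j` is strictly northeast of `i`, the cell diagonally next to `i` has an entry between `i + 3`
and `j`, since the two other cells of that `2 × 2` square have entries in between. -/
theorem exists_succ_succ (hi : 1 ≤ i) (hij : i < j) (hj : j ≤ μ.card) (hr : T.row i < T.row j)
    (hc : T.col i < T.col j) :
    ∃ e, i + 3 ≤ e ∧ e ≤ j ∧ T.row e = T.row i + 1 ∧ T.col e = T.col i + 1 := by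
  have hi' : i ≤ μ.card := by lia
  have hj1 : 1 ≤ j := by lia
  have hmem := T.pos_mem hj1 hj
  obtain ⟨e, he1, hen, her, hec⟩ := T.exists_entry (μ.up_left_mem hr hc hmem)
  obtain ⟨a, ha1, han, har, hac⟩ := T.exists_entry (μ.up_left_mem hr.le hc hmem)
  obtain ⟨b, hb1, hbn, hbr, hbc⟩ := T.exists_entry (μ.up_left_mem hr hc.le hmem)
  have hia := T.lt_of_row_le_col_le hi hi' ha1 han (by lia) (by lia) (by rintro rfl; lia)
  have hib := T.lt_of_row_le_col_le hi hi' hb1 hbn (by lia) (by lia) (by rintro rfl; lia)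
  have hae := T.lt_of_row_le_col_le ha1 han he1 hen (by lia) (by lia) (by rintro rfl; lia)
  have hbe := T.lt_of_row_le_col_le hb1 hbn he1 hen (by lia) (by lia) (by rintro rfl; lia)
  have hab : a ≠ b := by rintro rfl; lia
  refine ⟨e, by lia, ?_, her, hec⟩
  by_contra! hne
  have := T.lt_of_row_le_col_le he1 hen hj1 hj (by lia) (by lia) hne.ne'
  lia

theorem row_lt_and_col_lt_of_content_eq (hi : 1 ≤ i) (hij : i < j) (hj : j ≤ μ.card)
    (h : T.content i = T.content j) : T.row i < T.row j ∧ T.col i < T.col j := by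
  have := row_lt_or_col_lt (T := T) hi hij hj
  unfold content at h
  lia

theorem attacks_of_content_lt (hi : 1 ≤ i) (hij : i < j) (hij' : j ≤ i + 3) (hj : j ≤ μ.card)
    (h : T.content j < T.content i) : T.Attacks i j := by
  have h' := row_lt_or_col_lt (T := T) hi hij hj
  rcases le_or_gt (T.col j) (T.col i) with hc | hc
  · exact .southeast hi hij hj (by lia) hc
  · unfold content at h
    obtain ⟨e, he, hej, hr, hc'⟩ := exists_succ_succ hi (by lia) hj (by lia) hc
    obtain rfl : e = j := by lia
    lia

theorem attacks_iff_of_le_add_two (hi : 1 ≤ i) (hij : i < j) (hij' : j ≤ i + 2)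
    (hj : j ≤ μ.card) : T.Attacks i j ↔ T.content j < T.content i := by
  refine ⟨fun h => ?_, attacks_of_content_lt hi hij (by lia) hj⟩
  cases h with
  | southeast _ _ _ hr hc => unfold content; lia
  | southwest _ _ _ hr hc _ =>
    obtain ⟨e, he, hej, -⟩ := exists_succ_succ hi (by lia) hj hr hc
    lia

theorem attacks_add_three_iff (hi : 1 ≤ i) (hj : i + 3 ≤ μ.card) :
    T.Attacks i (i + 3) ↔ T.content (i + 3) < T.content i ∨
      (T.content (i + 3) = T.content i ∧ T.content (i + 3) < T.content (i + 1)) := by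
  constructor
  · intro h
    cases h with
    | southeast _ _ _ hr hc => unfold content; lia
    | southwest _ _ _ hr hc next =>
      obtain ⟨e, he, hej, her, hec⟩ := exists_succ_succ hi (by lia) hj hr hc
      obtain rfl : e = i + 3 := by lia
      rw [attacks_iff_of_le_add_two (by lia) (by lia) (by lia) hj] at next
      exact .inr ⟨by unfold content; lia, next⟩
  · rintro (h | ⟨h, h'⟩)
    · exact attacks_of_content_lt hi (by lia) le_rfl hj h
    · obtain ⟨hr, hc⟩ := row_lt_and_col_lt_of_content_eq hi (by lia) hj h.symm
      exact .southwest hi (by lia) hj hr hc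
        ((attacks_iff_of_le_add_two (by lia) (by lia) (by lia) hj).2 h')

theorem row_lt_succ_iff (hi : 1 ≤ i) (hi' : i + 1 ≤ μ.card) :
    T.row i < T.row (i + 1) ↔ T.content (i + 1) < T.content i := by
  have h := row_lt_or_col_lt (T := T) hi (Nat.lt_succ_self i) hi'
  refine ⟨fun hr => ?_, fun h' => ?_⟩
  · rcases le_or_gt (T.col (i + 1)) (T.col i) with hc | hc
    · unfold content; lia
    · obtain ⟨e, he, hej, -⟩ := exists_succ_succ hi (by lia) hi' hr hc
      lia
  · unfold content at h'
    lia

theorem row_ne_and_col_ne (hi : 1 ≤ i) (hi' : i + 1 ≤ μ.card)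
    (h : 1 < |T.content (i + 1) - T.content i|) :
    T.row i ≠ T.row (i + 1) ∧ T.col i ≠ T.col (i + 1) := by
  have h' := row_lt_or_col_lt (T := T) hi (Nat.lt_succ_self i) hi'
  have hmem := T.pos_mem (m := i + 1) (by lia) hi'
  rw [lt_abs] at h
  unfold content at h
  constructor
  · intro hr
    obtain ⟨e, he1, hen, her, hec⟩ := T.exists_entry (r := T.row i) (c := T.col i + 1)
      (μ.up_left_mem hr.le (by lia) hmem)
    have h1 := T.lt_of_row_le_col_le hi (by lia) he1 hen (by lia) (by lia) (by rintro rfl; lia)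
    have h2 := T.lt_of_row_le_col_le he1 hen (by lia) hi' (by lia) (by lia) (by rintro rfl; lia)
    lia
  · intro hc
    obtain ⟨e, he1, hen, her, hec⟩ := T.exists_entry (r := T.row i + 1) (c := T.col i)
      (μ.up_left_mem (by lia) hc.le hmem)
    have h1 := T.lt_of_row_le_col_le hi (by lia) he1 hen (by lia) (by lia) (by rintro rfl; lia)
    have h2 := T.lt_of_row_le_col_le he1 hen (by lia) hi' (by lia) (by lia) (by rintro rfl; lia)
    lia

end Geometry

/-! ### The statistics of a tableau in terms of its content word -/

section Statistics

/-- A sum over pairs `(i, i + k)`, indexed by `j = i + k - 1`. -/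
theorem sum_pairs (n k : ℕ) (hk : 1 ≤ k) (P : ℕ → ℕ → Prop) [∀ i j, Decidable (P i j)]
    (Q : ℕ → Prop) [DecidablePred Q] (f : ℕ → ℕ)
    (hPQ : ∀ i, 1 ≤ i → i + k ≤ n → (P i (i + k) ↔ Q (i + k - 1))) :
    ∑ p ∈ (Finset.Icc 1 n ×ˢ Finset.Icc 1 n) with p.2 = p.1 + k ∧ P p.1 p.2, f p.1 =
      ∑ j ∈ Finset.range n, if k ≤ j ∧ Q j then f (j + 1 - k) else 0 := by
  rw [← Finset.sum_filter]
  refine Finset.sum_bij' (fun p _ => p.2 - 1) (fun j _ => (j + 1 - k, j + 1)) ?_ ?_ ?_ ?_ ?_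
  · rintro ⟨a, b⟩ h
    simp only [Finset.mem_filter, Finset.mem_product, Finset.mem_Icc, Finset.mem_range] at h ⊢
    obtain ⟨h, rfl, hP⟩ := h
    exact ⟨by lia, by lia, (hPQ a (by lia) (by lia)).1 hP⟩
  · intro j h
    simp only [Finset.mem_filter, Finset.mem_product, Finset.mem_Icc, Finset.mem_range] at h ⊢
    have := hPQ (j + 1 - k) (by lia) (by lia)
    rw [show j + 1 - k + k = j + 1 by lia, Nat.add_sub_cancel] at this
    exact ⟨by lia, by lia, this.2 h.2.2⟩
  · rintro ⟨a, b⟩ h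
    simp only [Finset.mem_filter, Finset.mem_product, Finset.mem_Icc] at h
    ext <;> simp only <;> lia
  · intro j h
    simp
  · rintro ⟨a, b⟩ h
    simp only [Finset.mem_filter, Finset.mem_product, Finset.mem_Icc] at h
    congr 1
    simp only
    lia

variable (T : StandardYoungTableau μ)

theorem maj_eq_stat : T.maj = stat majInc (ofSeq T.content μ.card) := by
  rw [stat_majInc_ofSeq, maj, des]
  exact sum_pairs _ 1 le_rfl (fun i j => T.row i < T.row j) _ id
    fun i h1 h2 => row_lt_succ_iff h1 h2

theorem sum_desK_one (f : ℕ → ℕ) : ∑ p ∈ T.desK 1, f p.1 = ∑ j ∈ Finset.range μ.card,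
    if 1 ≤ j ∧ T.content (j + 1) < T.content j then f j else 0 :=
  sum_pairs _ 1 le_rfl _ (fun j => T.content (j + 1) < T.content j) f
    fun _ h1 h2 => attacks_iff_of_le_add_two h1 (by lia) (by lia) h2

theorem sum_desK_two (f : ℕ → ℕ) : ∑ p ∈ T.desK 2, f p.1 = ∑ j ∈ Finset.range μ.card,
    if 2 ≤ j ∧ T.content (j + 1) < T.content (j - 1) then f (j - 1) else 0 :=
  sum_pairs _ 2 (by lia) _ (fun j => T.content (j + 1) < T.content (j - 1)) f
    fun _ h1 h2 => attacks_iff_of_le_add_two h1 (by lia) (by lia) h2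

theorem sum_desK_three (f : ℕ → ℕ) : ∑ p ∈ T.desK 3, f p.1 = ∑ j ∈ Finset.range μ.card,
    if 3 ≤ j ∧ (T.content (j + 1) < T.content (j - 2) ∨
      (T.content (j + 1) = T.content (j - 2) ∧ T.content (j + 1) < T.content (j - 1)))
    then f (j - 2) else 0 :=
  sum_pairs _ 3 (by lia) _ (fun j => T.content (j + 1) < T.content (j - 2) ∨
      (T.content (j + 1) = T.content (j - 2) ∧ T.content (j + 1) < T.content (j - 1))) f
    fun _ h1 h2 => attacks_add_three_iff h1 h2

theorem majK_two_eq_stat : T.majK 2 = stat majInc₂ (ofSeq T.content μ.card) := by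
  have : T.invK 2 = T.desK 1 := by simp [invK, show Finset.Ico 1 2 = {1} from rfl]
  rw [stat_majInc₂_ofSeq, majK, this, Finset.card_eq_sum_ones, T.sum_desK_one fun _ => 1,
    T.sum_desK_two fun i => i, Finset.sum_add_distrib]

theorem majK_three_eq_stat : T.majK 3 = stat majInc₃ (ofSeq T.content μ.card) := by
  have h : T.invK 3 = T.desK 1 ∪ T.desK 2 := by
    simp [invK, show Finset.Ico 1 3 = {1, 2} from rfl]
  have hdisj : Disjoint (T.desK 1) (T.desK 2) := by
    rw [Finset.disjoint_left]
    intro p h1 h2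
    have := (Finset.mem_filter.1 h1).2.1
    have := (Finset.mem_filter.1 h2).2.1
    lia
  rw [stat_majInc₃_ofSeq, majK, h, Finset.card_union_of_disjoint hdisj, Finset.card_eq_sum_ones,
    Finset.card_eq_sum_ones, T.sum_desK_one fun _ => 1, T.sum_desK_two fun _ => 1,
    T.sum_desK_three fun i => i, Finset.sum_add_distrib, Finset.sum_add_distrib]

end Statistics

/-! ### The set of content words -/

section Swap

/-- Consecutive entries whose contents differ by at least `2` lie in different rows and columns, so
they can be exchanged in a standard tableau. -/
theorem exists_swap (T : StandardYoungTableau μ) {i : ℕ} (hi : 1 ≤ i) (hi' : i + 1 ≤ μ.card)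
    (h : 1 < |T.content (i + 1) - T.content i|) :
    ∃ T' : StandardYoungTableau μ, ∀ m, 1 ≤ m → m ≤ μ.card →
      T'.content m = T.content (Equiv.swap i (i + 1) m) := by
  obtain ⟨hrow, hcol⟩ := row_ne_and_col_ne hi hi' h
  let x : Finset.Icc 1 μ.card := ⟨i, Finset.mem_Icc.2 ⟨hi, by lia⟩⟩
  let y : Finset.Icc 1 μ.card := ⟨i + 1, Finset.mem_Icc.2 ⟨by lia, hi'⟩⟩
  have hval : ∀ m, (Equiv.swap x y m : ℕ) = Equiv.swap i (i + 1) (m : ℕ) := fun m => by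
    simp only [Equiv.swap_apply_def, Subtype.ext_iff, x, y]
    split_ifs <;> rfl
  have hmono : ∀ c d, (T.label c : ℕ) < T.label d →
      ¬ ((T.label c : ℕ) = i ∧ (T.label d : ℕ) = i + 1) →
      (Equiv.swap x y (T.label c) : ℕ) < Equiv.swap x y (T.label d) := fun c d hlt hne => by
    rw [hval, hval, Equiv.swap_apply_def, Equiv.swap_apply_def]
    split_ifs <;> lia
  let T' : StandardYoungTableau μ :=
    { label := T.label.trans (Equiv.swap x y)
      row_lt := fun c d hr hc => hmono c d (T.row_lt c d hr hc) fun ⟨h1, h2⟩ => hrow <| by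
        rw [← h2, ← h1, row, row, pos_label, pos_label, hr]
      col_lt := fun c d hc hr => hmono c d (T.col_lt c d hc hr) fun ⟨h1, h2⟩ => hcol <| by
        rw [← h2, ← h1, col, col, pos_label, pos_label, hc] }
  refine ⟨T', fun m h1 hm => ?_⟩
  obtain ⟨c, rfl⟩ := T'.exists_cell h1 hm
  have : Equiv.swap i (i + 1) (T'.label c : ℕ) = T.label c := by
    rw [show T'.label c = Equiv.swap x y (T.label c) from rfl, hval, Equiv.swap_apply_self]
  rw [this, content, content, row, row, col, col, pos_label, pos_label]

/-- A tableau is determined by its contents: each diagonal is filled from the southwest. -/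
theorem eq_of_content_eq {T T' : StandardYoungTableau μ}
    (h : ∀ m, 1 ≤ m → m ≤ μ.card → T.content m = T'.content m) : T = T' := by
  have key : ∀ m, 1 ≤ m → m ≤ μ.card → T.row m = T'.row m ∧ T.col m = T'.col m := by
    intro m
    induction m using Nat.strong_induction_on with
    | _ m ih =>
    intro h1 hm
    have hc := h m h1 hm
    unfold content at hc
    rcases lt_trichotomy (T.row m) (T'.row m) with hlt | heq | hlt
    · obtain ⟨e, he1, hen, her, hec⟩ := T'.exists_entry (T.pos_mem h1 hm)
      have hem := T'.lt_of_row_le_col_le he1 hen h1 hm (by lia) (by lia) (by rintro rfl; lia)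
      have he := ih e hem he1 hen
      have := row_lt_or_col_lt (T := T) he1 hem hm
      lia
    · lia
    · obtain ⟨e, he1, hen, her, hec⟩ := T.exists_entry (T'.pos_mem h1 hm)
      have hem := T.lt_of_row_le_col_le he1 hen h1 hm (by lia) (by lia) (by rintro rfl; lia)
      have he := ih e hem he1 hen
      have := row_lt_or_col_lt (T := T') he1 hem hm
      lia
  have hlabel : T.label = T'.label := by
    rw [← Equiv.symm_bijective.injective.eq_iff]
    ext m : 1
    obtain ⟨h1, hm⟩ := Finset.mem_Icc.1 m.2
    obtain ⟨hr, hc⟩ := key m h1 hm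
    simp only [row, col, pos, dif_pos m.2] at hr hc
    exact Subtype.ext (Prod.ext hr hc)
  cases T
  cases T'
  cases hlabel
  rfl

variable (μ) in
/-- The content words of the standard tableaux of shape `μ`. -/
noncomputable def contentWords : Finset (List ℤ) :=
  Finset.univ.image fun T : StandardYoungTableau μ => ofSeq T.content μ.card

variable (μ) in
theorem isCommClosed_contentWords : IsCommClosed μ.card (contentWords μ) where
  length_eq v hv := by
    obtain ⟨T, -, rfl⟩ := Finset.mem_image.1 hv
    exact length_ofSeq _ _
  swap_mem s a b t hv hab := by
    obtain ⟨T, -, hT⟩ := Finset.mem_image.1 hv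
    have ht : t = ofSeq T.content t.length :=
      (ofSeq_eq_append (s := s ++ [a, b]) (by simpa using hT)).1
    obtain ⟨hab', hl⟩ := ofSeq_eq_append hT
    rw [List.length_cons, List.length_cons, ofSeq, ofSeq, List.cons.injEq, List.cons.injEq] at hab'
    obtain ⟨rfl, rfl, -⟩ := hab'
    obtain ⟨T', hT'⟩ := T.exists_swap (i := t.length + 1) (by lia) hl hab
    refine Finset.mem_image.2 ⟨T', Finset.mem_univ _, ?_⟩
    generalize t.length = i at *
    subst ht
    rw [← ofSeq_comp_swap hT, ofSeq_congr]
    exact hT'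
  not_mem_aa s a t hv := by
    obtain ⟨T, -, hT⟩ := Finset.mem_image.1 hv
    obtain ⟨h, hl⟩ := ofSeq_eq_append hT
    simp only [List.length_cons, ofSeq, List.cons.injEq] at h hl
    obtain ⟨hr, hc⟩ := row_lt_and_col_lt_of_content_eq (by lia) (Nat.lt_succ_self _) hl
      (h.2.1.symm.trans h.1)
    obtain ⟨e, he, hej, -⟩ := exists_succ_succ (by lia) (by lia) hl hr hc
    lia
  not_mem_aba s a b t hv := by
    obtain ⟨T, -, hT⟩ := Finset.mem_image.1 hv
    obtain ⟨h, hl⟩ := ofSeq_eq_append hT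
    simp only [List.length_cons, ofSeq, List.cons.injEq] at h hl
    obtain ⟨hr, hc⟩ := row_lt_and_col_lt_of_content_eq (by lia) (by lia) hl
      (h.2.2.1.symm.trans h.1)
    obtain ⟨e, he, hej, -⟩ := exists_succ_succ (by lia) (by lia) hl hr hc
    lia

theorem sum_contentWords {R : Type*} [CommRing R] (f : List ℤ → R) :
    ∑ v ∈ contentWords μ, f v =
      ∑ T : StandardYoungTableau μ, f (ofSeq T.content μ.card) :=
  Finset.sum_image fun _ _ _ _ h => eq_of_content_eq (ofSeq_congr.1 h)

end Swap

end StandardYoungTableau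

theorem theorem4p3 (μ : YoungDiagram) :
    (∑ T : StandardYoungTableau μ, (Polynomial.X : Polynomial ℕ) ^ T.maj =
      ∑ T : StandardYoungTableau μ, (Polynomial.X : Polynomial ℕ) ^ T.majK 2) ∧
    (∑ T : StandardYoungTableau μ, (Polynomial.X : Polynomial ℕ) ^ T.majK 2 =
      ∑ T : StandardYoungTableau μ, (Polynomial.X : Polynomial ℕ) ^ T.majK 3) := by
  have hW := StandardYoungTableau.isCommClosed_contentWords μ
  have h₂ := ContentWord.sum_majInc₂_eq_sum_majInc (Polynomial.X : Polynomial ℤ) _ _ hW 1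
  have h₃ := ContentWord.sum_majInc₃_eq_sum_majInc (Polynomial.X : Polynomial ℤ) _ _ hW 1
  simp only [Pi.one_apply, one_mul, StandardYoungTableau.sum_contentWords,
    ← StandardYoungTableau.maj_eq_stat, ← StandardYoungTableau.majK_two_eq_stat,
    ← StandardYoungTableau.majK_three_eq_stat] at h₂ h₃
  -- The exchange laws need subtraction, so the identities are proved over `ℤ` and pulled back.
  have hinj := Polynomial.map_injective (Nat.castRingHom ℤ) Nat.cast_injective
  constructor <;> apply hinj <;>
    simp only [Polynomial.map_sum, Polynomial.map_pow, Polynomial.map_X]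
  · exact h₂.symm
  · exact h₂.trans h₃.symm
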